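/- Let $\mathcal H,\mathcal K$ be complex Hilbert spaces, let $\mathbb P(\mathcal H)$ be the set of positive invertible bounded operators on $\mathcal H$, and let $\le$ be the operator order. For a probability vector $\omega=(\omega_1,\dots,\omega_n)$ put $\mathcal A_\omega(A_1,\dots,A_n)=\sum_j\omega_jA_j$ and $\mathcal H_\omega(A_1,\dots,A_n)=\bigl(\sum_j\omega_jA_j^{-1}\bigr)^{-1}$. An ($2$-variable) operator mean $\sigma$ is a binary operation on positive operators which, on every Hilbert space, satisfies the Kubo--Ando axioms: (i) $A\le C$, $B\le D$ imply $A\,\sigma\,B\le C\,\sigma\,D$; (ii) $C(A\,\sigma\,B)C\le (CAC)\,\sigma\,(CBC)$ for $C\ge 0$; (iii) $A_k\searrow A$, $B_k\searrow B$ imply $A_k\,\sigma\,B_k\searrow A\,\sigma\,B$ (decreasing sequences, strong operator convergence); (iv) $I\,\sigma\,I=I$; its representing function $f_\sigma$, given by $I\,\sigma\,(xI)=f_\sigma(x)I$ for $x>0$, does not depend on the space. The left trivial mean is $A\,\ell\,B=A$. An $n$-variable operator mean is a map $\mathfrak M:\mathbb P^n\to\mathbb P$ that is (I) monotone in each variable;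 (II) congruence invariant, $S^*\mathfrak M(A_1,\dots,A_n)S=\mathfrak M(S^*A_1S,\dots,S^*A_nS)$ for invertible $S$; (III) monotone continuous: if $A_{jk}\nearrow A_j$ for all $j$, or $A_{jk}\searrow A_j$ for all $j$, with all these operators in $\mathbb P$, then $\mathfrak M(A_{1k},\dots,A_{nk})\to\mathfrak M(A_1,\dots,A_n)$ strongly; and (IV) normalized, $\mathfrak M(I,\dots,I)=I$. For $\sigma\ne\ell$ the deformed mean $\mathfrak M_\sigma(A_1,\dots,A_n)$ is the unique solution $X\in\mathbb P$ of $X=\mathfrak M(X\,\sigma\,A_1,\dots,X\,\sigma\,A_n)$. **Corollary 2.3.** Let $0<m<M$ be scalars, let $A_1,\dots,A_n\in\mathbb P(\mathcal H)$ with $mI\le A_j\le MI$ for all $j$, and let $\Phi:\mathbb B(\mathcal H)\to\mathbb B(\mathcal K)$ be a unital positive linear map. Let $\mathfrak M$ be an $n$-variable operator mean, given on $\mathbb P(\mathcal H)$ and on $\mathbb P(\mathcal K)$, with $\mathcal H_\omega\le\mathfrak M\le\mathcal A_\omega$ on both for some probability vector $\omega$, and let $\sigma\neq\ell$ be an operator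 mean. Then $$\mathfrak M_\sigma(\Phi(A_1),\dots,\Phi(A_n))\le\frac{(M+m)^2}{4Mm}\,\Phi(\mathfrak M_\sigma(A_1,\dots,A_n))$$ and $$\mathfrak M_\sigma(\Phi(A_1),\dots,\Phi(A_n))\le\Phi(\mathfrak M_\sigma(A_1,\dots,A_n))+(\sqrt M-\sqrt m)^2I .$$ -/

import Mathlib

open Filter Topology

universe u

/-- `T k ↘ S`: the sequence is decreasing in the operator order and converges to `S` in the
strong operator topology. -/
def DecreasesTo {H : Type*} [NormedAddCommGroup H] [InnerProductSpace ℂ H] [CompleteSpace H]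
    (T : ℕ → H →L[ℂ] H) (S : H →L[ℂ] H) : Prop :=
  Antitone T ∧ ∀ v : H, Tendsto (fun k => T k v) atTop (𝓝 (S v))

/-- `T k ↗ S`: the sequence is increasing in the operator order and converges to `S` in the
strong operator topology. -/
def IncreasesTo {H : Type*} [NormedAddCommGroup H] [InnerProductSpace ℂ H] [CompleteSpace H]
    (T : ℕ → H →L[ℂ] H) (S : H →L[ℂ] H) : Prop :=
  Monotone T ∧ ∀ v : H, Tendsto (fun k => T k v) atTop (𝓝 (S v))

/-- The Kubo--Ando axioms for a binary operation on the cone of positive operators of a fixed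
Hilbert space. The values of `s` at non-positive operators are irrelevant. -/
structure IsOperatorMean {H : Type*} [NormedAddCommGroup H] [InnerProductSpace ℂ H]
    [CompleteSpace H] (s : (H →L[ℂ] H) → (H →L[ℂ] H) → (H →L[ℂ] H)) : Prop where
  nonneg : ∀ A B, 0 ≤ A → 0 ≤ B → 0 ≤ s A B
  mono : ∀ A B C D, 0 ≤ A → 0 ≤ B → A ≤ C → B ≤ D → s A B ≤ s C D
  transformer : ∀ A B C, 0 ≤ A → 0 ≤ B → 0 ≤ C → C * s A B * C ≤ s (C * A * C) (C * B * C)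
  downward : ∀ (A B : ℕ → H →L[ℂ] H) (A' B' : H →L[ℂ] H),
    (∀ k, 0 ≤ A k) → (∀ k, 0 ≤ B k) → 0 ≤ A' → 0 ≤ B' →
    DecreasesTo A A' → DecreasesTo B B' → DecreasesTo (fun k => s (A k) (B k)) (s A' B')
  normalized : s 1 1 = 1

/-- A two-variable operator mean that can be applied on every Hilbert space: on each space it
satisfies the Kubo--Ando axioms, and the operations on different spaces are the same mean, i.e.
they have the same representing function `f`, given by `I σ (x I) = f(x) I` for `x > 0`. -/
structure OperatorMean where
  op : ∀ (H : Type u) [NormedAddCommGroup H] [InnerProductSpace ℂ H] [CompleteSpace H],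
    (H →L[ℂ] H) → (H →L[ℂ] H) → (H →L[ℂ] H)
  isOperatorMean : ∀ (H : Type u) [NormedAddCommGroup H] [InnerProductSpace ℂ H]
    [CompleteSpace H], IsOperatorMean (op H)
  exists_representing : ∃ f : ℝ → ℝ, ∀ (H : Type u) [NormedAddCommGroup H]
    [InnerProductSpace ℂ H] [CompleteSpace H] (x : ℝ), 0 < x →
    op H 1 (x • (1 : H →L[ℂ] H)) = f x • (1 : H →L[ℂ] H)

/-- `σ` is the left trivial mean `A ℓ B = A`. -/
def OperatorMean.IsLeftTrivial (σ : OperatorMean.{u}) : Prop :=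
  ∀ (H : Type u) [NormedAddCommGroup H] [InnerProductSpace ℂ H] [CompleteSpace H]
    (A B : H →L[ℂ] H), 0 ≤ A → 0 ≤ B → σ.op H A B = A

/-- An `n`-variable operator mean on the positive invertible operators of `H`. The values of `𝔐`
at tuples that are not positive invertible are irrelevant. -/
structure IsMultivariateMean {H : Type*} [NormedAddCommGroup H] [InnerProductSpace ℂ H]
    [CompleteSpace H] {n : ℕ} (𝔐 : (Fin n → H →L[ℂ] H) → (H →L[ℂ] H)) : Prop where
  pos : ∀ A, (∀ j, IsStrictlyPositive (A j)) → IsStrictlyPositive (𝔐 A)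
  mono : ∀ A B, (∀ j, IsStrictlyPositive (A j)) → (∀ j, IsStrictlyPositive (B j)) →
    (∀ j, A j ≤ B j) → 𝔐 A ≤ 𝔐 B
  congruence : ∀ A (S : H →L[ℂ] H), (∀ j, IsStrictlyPositive (A j)) → IsUnit S →
    star S * 𝔐 A * S = 𝔐 (fun j => star S * A j * S)
  monotone_continuity : ∀ (A : ℕ → Fin n → H →L[ℂ] H) (A' : Fin n → H →L[ℂ] H),
    (∀ k j, IsStrictlyPositive (A k j)) → (∀ j, IsStrictlyPositive (A' j)) →
    ((∀ j, IncreasesTo (fun k => A k j) (A' j)) ∨ (∀ j, DecreasesTo (fun k => A k j) (A' j))) →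
    ∀ v : H, Tendsto (fun k => 𝔐 (A k) v) atTop (𝓝 (𝔐 A' v))
  normalized : 𝔐 (fun _ => 1) = 1

/-- The weighted arithmetic mean. -/
noncomputable def arithMean {H : Type*} [NormedAddCommGroup H] [InnerProductSpace ℂ H]
    [CompleteSpace H] {n : ℕ} (ω : Fin n → ℝ) (A : Fin n → H →L[ℂ] H) : H →L[ℂ] H :=
  ∑ j, ω j • A j

/-- The weighted harmonic mean. -/
noncomputable def harmMean {H : Type*} [NormedAddCommGroup H] [InnerProductSpace ℂ H]
    [CompleteSpace H] {n : ℕ} (ω : Fin n → ℝ) (A : Fin n → H →L[ℂ] H) : H →L[ℂ] H :=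
  Ring.inverse (∑ j, ω j • Ring.inverse (A j))

/-- `𝓗_ω ≤ 𝔐 ≤ 𝓐_ω` on all tuples of positive invertible operators. -/
def BetweenHarmArith {H : Type*} [NormedAddCommGroup H] [InnerProductSpace ℂ H]
    [CompleteSpace H] {n : ℕ} (ω : Fin n → ℝ) (𝔐 : (Fin n → H →L[ℂ] H) → (H →L[ℂ] H)) : Prop :=
  ∀ A, (∀ j, IsStrictlyPositive (A j)) → harmMean ω A ≤ 𝔐 A ∧ 𝔐 A ≤ arithMean ω A

/-- The deformed mean `𝔐_σ(A₁, …, Aₙ)`: the positive invertible solution `X` of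
`X = 𝔐(X σ A₁, …, X σ Aₙ)`. -/
noncomputable def deformedMean {H : Type u} [NormedAddCommGroup H] [InnerProductSpace ℂ H]
    [CompleteSpace H] {n : ℕ} (𝔐 : (Fin n → H →L[ℂ] H) → (H →L[ℂ] H)) (σ : OperatorMean.{u})
    (A : Fin n → H →L[ℂ] H) : H →L[ℂ] H :=
  Classical.epsilon fun X : H →L[ℂ] H =>
    IsStrictlyPositive X ∧ X = 𝔐 (fun j => σ.op H X (A j))

/-! The core fact is that every deformed mean inherits the bounds `harmMean ω A ≤ X ≤ arithMean ω
A`. A mean `σ` other than the left trivial one satisfies `A σ B ≤ (1 - α) A + α B` and `(A σ B)⁻¹ ≤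
(1 - β) A⁻¹ + β B⁻¹` with `α, β > 0` (`OperatorMean.exists_affine_bounds`). Inserting the first into
`X = 𝔐(X σ A₁, …) ≤ ∑ ωⱼ (X σ Aⱼ)` gives `X ≤ (1 - α) X + α ∑ ωⱼ Aⱼ`, and `X` cancels; the second
gives the harmonic bound in the same way.

The affine bounds are tangent lines at `1` to the representing function `f` and to `x ↦ f(x⁻¹)⁻¹`.
Both tangents exist by concavity at `1`, which comes from compressing to rank-one projections; no
integral representation and no functional calculus for `f` is needed. The tangents have positive
slope because `f` is not constantly `1`.

Since `Φ` is linear and unital, it commutes with `arithMean` and preserves the bounds `m`, `M`.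
Hence the deformed mean of the `Φ(Aⱼ)` is at most `Φ(arithMean ω A)`. Kantorovich-type inequalities
compare `arithMean ω A` with `harmMean ω A`, which lies below the deformed mean of the `Aⱼ`. -/

theorem ringInverse_eq_of_mul_eq_one {M₀ : Type*} [MonoidWithZero M₀] {a b : M₀}
    (h : a * b = 1) (h' : b * a = 1) : Ring.inverse a = b :=
  Ring.inverse_unit ⟨a, b, h, h'⟩

/-! ### Quadratic forms, order bounds and monotone limits of operators. -/

section Operators

variable {H : Type*} [NormedAddCommGroup H] [InnerProductSpace ℂ H]

open ContinuousLinearMap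

theorem reApplyInnerSelf_add (A B : H →L[ℂ] H) (v : H) :
    (A + B).reApplyInnerSelf v = A.reApplyInnerSelf v + B.reApplyInnerSelf v := by
  simp [reApplyInnerSelf_apply, inner_add_left]

theorem reApplyInnerSelf_sub (A B : H →L[ℂ] H) (v : H) :
    (A - B).reApplyInnerSelf v = A.reApplyInnerSelf v - B.reApplyInnerSelf v := by
  simp [reApplyInnerSelf_apply, inner_sub_left]

theorem reApplyInnerSelf_real_smul (c : ℝ) (A : H →L[ℂ] H) (v : H) :
    (c • A).reApplyInnerSelf v = c * A.reApplyInnerSelf v := by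
  rw [reApplyInnerSelf_apply, reApplyInnerSelf_apply, _root_.smul_apply,
    ← Complex.coe_smul, inner_smul_left]
  simp

theorem reApplyInnerSelf_one (v : H) :
    (1 : H →L[ℂ] H).reApplyInnerSelf v = ‖v‖ ^ 2 := by
  rw [reApplyInnerSelf_apply, one_apply_eq_self, inner_self_eq_norm_sq_to_K]
  norm_cast

theorem reApplyInnerSelf_real_smul_right (A : H →L[ℂ] H) (c : ℝ) (v : H) :
    A.reApplyInnerSelf (c • v) = c ^ 2 * A.reApplyInnerSelf v := by
  have := A.reApplyInnerSelf_smul v (c := (c : ℂ))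
  simpa using this

theorem reApplyInnerSelf_mono {A B : H →L[ℂ] H} (h : A ≤ B) (v : H) :
    A.reApplyInnerSelf v ≤ B.reApplyInnerSelf v := by
  have := ((ContinuousLinearMap.le_def A B).1 h).2 v
  have h2 : 0 ≤ (B - A).reApplyInnerSelf v := this
  rw [reApplyInnerSelf_sub] at h2
  linarith

theorem nonneg_of_tendsto_apply {T : ℕ → H →L[ℂ] H} {S : H →L[ℂ] H} (hT : ∀ k, 0 ≤ T k)
    (h : ∀ v, Tendsto (fun k => T k v) atTop (𝓝 (S v))) : 0 ≤ S := by
  rw [nonneg_iff_isPositive, isPositive_iff_complex]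
  intro v
  have h1 : Tendsto (fun k => inner ℂ (T k v) v) atTop (𝓝 (inner ℂ (S v) v)) :=
    (h v).inner tendsto_const_nhds
  have hp := fun k => (isPositive_iff_complex _).1 ((nonneg_iff_isPositive _).1 (hT k)) v
  have h2 : Tendsto (fun k => RCLike.re (inner ℂ (T k v) v)) atTop
      (𝓝 (RCLike.re (inner ℂ (S v) v))) := (RCLike.continuous_re.tendsto _).comp h1
  refine ⟨tendsto_nhds_unique ?_ h1, ge_of_tendsto' h2 fun k => (hp k).2⟩
  have h3 : Tendsto (fun k => ((RCLike.re (inner ℂ (T k v) v) : ℝ) : ℂ)) atTop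
      (𝓝 ((RCLike.re (inner ℂ (S v) v) : ℝ) : ℂ)) := (Complex.continuous_ofReal.tendsto _).comp h2
  exact h3.congr fun k => (hp k).1

variable [CompleteSpace H]

theorem le_of_tendsto_apply {T : ℕ → H →L[ℂ] H} {S L : H →L[ℂ] H} (hT : ∀ k, L ≤ T k)
    (h : ∀ v, Tendsto (fun k => T k v) atTop (𝓝 (S v))) : L ≤ S := by
  rw [← sub_nonneg]
  refine nonneg_of_tendsto_apply (T := fun k => T k - L) (fun k => sub_nonneg.2 (hT k)) fun v => ?_
  simpa using (h v).sub_const (L v)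

theorem le_of_reApplyInnerSelf_le {A B : H →L[ℂ] H} (hA : IsSelfAdjoint A)
    (hB : IsSelfAdjoint B) (h : ∀ v, ‖v‖ = 1 → A.reApplyInnerSelf v ≤ B.reApplyInnerSelf v) :
    A ≤ B := by
  rw [ContinuousLinearMap.le_def, isPositive_def']
  refine ⟨hB.sub hA, fun v => ?_⟩
  rcases eq_or_ne v 0 with rfl | hv
  · simp [reApplyInnerSelf_apply]
  have hv' : ‖v‖ ≠ 0 := norm_ne_zero_iff.2 hv
  have h1 := h ((‖v‖⁻¹ : ℝ) • v) (by rw [norm_smul]; simp [hv'])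
  rw [reApplyInnerSelf_real_smul_right, reApplyInnerSelf_real_smul_right] at h1
  rw [reApplyInnerSelf_sub]
  have : 0 < ‖v‖⁻¹ ^ 2 := by positivity
  linarith [le_of_mul_le_mul_left h1 this]

/-- Write `D = R²` and use `‖R (R v)‖ ≤ ‖R‖ ‖R v‖`. This upgrades convergence of quadratic forms to
strong convergence for monotone sequences. -/
theorem norm_apply_sq_le {D : H →L[ℂ] H} (hD : 0 ≤ D) (v : H) :
    ‖D v‖ ^ 2 ≤ ‖D‖ * D.reApplyInnerSelf v := by
  set R := CFC.sqrt D with hR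
  have hRR : R * R = D := CFC.sqrt_mul_sqrt_self D hD
  have hRs : IsSelfAdjoint R := IsSelfAdjoint.of_nonneg (CFC.sqrt_nonneg D)
  have h1 : D.reApplyInnerSelf v = ‖R v‖ ^ 2 := by
    rw [reApplyInnerSelf_apply, ← hRR, mul_apply_eq_comp, ← adjoint_inner_right, ← star_eq_adjoint,
      hRs.star_eq, inner_self_eq_norm_sq_to_K]
    norm_cast
  have h2 : ‖R‖ ^ 2 = ‖D‖ := by
    rw [← hRR, hRs.norm_mul_self]
  have h3 : ‖D v‖ ≤ ‖R‖ * ‖R v‖ := by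
    rw [← hRR, mul_apply_eq_comp]; exact R.le_opNorm _
  rw [h1, ← h2, ← mul_pow]
  gcongr

/-- The quadratic forms decrease and are bounded below, hence are Cauchy; `norm_apply_sq_le` applied
to the differences makes each orbit `T k v` Cauchy, since the norms of the differences stay bounded.
-/
theorem exists_decreasesTo_of_antitone {T : ℕ → H →L[ℂ] H} {L : H →L[ℂ] H}
    (hT : Antitone T) (hL : ∀ k, L ≤ T k) : ∃ S, L ≤ S ∧ DecreasesTo T S := by
  have hbd : ∀ j k, j ≤ k → ‖T j - T k‖ ≤ ‖T 0 - L‖ := fun j k hjk =>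
    CStarAlgebra.norm_le_norm_of_nonneg_of_le (sub_nonneg.2 (hT hjk))
      (sub_le_sub (hT (Nat.zero_le j)) (hL k))
  have hcau : ∀ v, CauchySeq fun k => T k v := by
    intro v
    have hq : Antitone fun k => (T k).reApplyInnerSelf v := fun j k hjk =>
      reApplyInnerSelf_mono (hT hjk) v
    have hqc : CauchySeq fun k => (T k).reApplyInnerSelf v :=
      (tendsto_atTop_ciInf hq ⟨L.reApplyInnerSelf v, by
        rintro _ ⟨k, rfl⟩; exact reApplyInnerSelf_mono (hL k) v⟩).cauchySeq
    rw [Metric.cauchySeq_iff'] at hqc ⊢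
    intro ε hε
    -- The `+ 1` keeps the denominator positive when `T 0 = L`.
    obtain ⟨N, hN⟩ := hqc (ε ^ 2 / (‖T 0 - L‖ + 1)) (by positivity)
    refine ⟨N, fun k hk => ?_⟩
    have h1 := norm_apply_sq_le (sub_nonneg.2 (hT hk)) v
    have h2 := hN k hk
    rw [Real.dist_eq, abs_sub_comm] at h2
    have h3 := lt_of_le_of_lt (le_abs_self _) h2
    rw [← reApplyInnerSelf_sub, lt_div_iff₀ (by positivity)] at h3
    have h4 : 0 ≤ (T N - T k).reApplyInnerSelf v := by
      rw [reApplyInnerSelf_sub]; exact sub_nonneg.2 (hq hk)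
    have h5 : ‖(T N - T k) v‖ ^ 2 < ε ^ 2 := by
      nlinarith [hbd N k hk, mul_le_mul_of_nonneg_right (hbd N k hk) h4]
    rw [dist_eq_norm, norm_sub_rev]
    exact lt_of_pow_lt_pow_left₀ 2 hε.le (by simpa using h5)
  choose g hg using fun v => cauchySeq_tendsto_of_complete (hcau v)
  let S : H →L[ℂ] H := continuousLinearMapOfTendsto T (tendsto_pi_nhds.2 hg)
  have hS : ∀ v, Tendsto (fun k => T k v) atTop (𝓝 (S v)) := hg
  exact ⟨S, le_of_tendsto_apply hL hS, hT, hS⟩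

theorem IsStrictlyPositive.of_smul_one_le {c : ℝ} (hc : 0 < c) {A : H →L[ℂ] H}
    (h : c • (1 : H →L[ℂ] H) ≤ A) : IsStrictlyPositive A := by
  refine IsStrictlyPositive.of_le ?_ h
  exact isStrictlyPositive_one.smul hc

theorem exists_le_smul_one {A : H →L[ℂ] H} (hA : IsSelfAdjoint A) :
    ∃ c : ℝ, 0 < c ∧ A ≤ c • (1 : H →L[ℂ] H) := by
  refine ⟨‖A‖ + 1, by positivity, ?_⟩
  have h1 := hA.le_algebraMap_norm_self
  rw [Algebra.algebraMap_eq_smul_one] at h1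
  refine h1.trans ?_
  rw [add_smul, one_smul]
  exact le_add_of_nonneg_right zero_le_one

theorem IsStrictlyPositive.exists_smul_one_le {A : H →L[ℂ] H} (hA : IsStrictlyPositive A) :
    ∃ c : ℝ, 0 < c ∧ c • (1 : H →L[ℂ] H) ≤ A := by
  obtain ⟨r, hr, h⟩ := exists_le_smul_one hA.ringInverse.isSelfAdjoint
  refine ⟨r⁻¹, inv_pos.2 hr, ?_⟩
  have h1 := CStarAlgebra.ringInverse_le_ringInverse h hA.ringInverse
  rwa [Ring.inverse_inverse hA.isUnit, ringInverse_eq_of_mul_eq_one (b := r⁻¹ • 1)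
    (by simp [smul_smul, hr.ne']) (by simp [smul_smul, hr.ne'])] at h1

end Operators

/-! ### Rank-one operators and quadratic forms of inverses. -/

section RankOne

open ContinuousLinearMap InnerProductSpace

variable {H : Type*} [NormedAddCommGroup H] [InnerProductSpace ℂ H]

theorem reApplyInnerSelf_rankOne (v u : H) :
    (rankOne ℂ v v).reApplyInnerSelf u = ‖inner ℂ v u‖ ^ 2 := by
  rw [reApplyInnerSelf_apply, inner_left_rankOne_apply, ← inner_conj_symm u v, RCLike.conj_mul]
  norm_cast

theorem apply_ringInverse_apply {B : H →L[ℂ] H} (hB : IsUnit B) (v : H) :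
    B (Ring.inverse B v) = v := by
  rw [← mul_apply_eq_comp, Ring.mul_inverse_cancel B hB, one_apply_eq_self]

theorem reApplyInnerSelf_ringInverse {B : H →L[ℂ] H} (hB : IsUnit B) (v : H) :
    (Ring.inverse B).reApplyInnerSelf v = B.reApplyInnerSelf (Ring.inverse B v) := by
  rw [reApplyInnerSelf_apply, reApplyInnerSelf_apply, apply_ringInverse_apply hB, inner_re_symm]

variable [CompleteSpace H]

theorem ofReal_reApplyInnerSelf {B : H →L[ℂ] H} (hB : IsSelfAdjoint B) (v : H) :
    ((B.reApplyInnerSelf v : ℝ) : ℂ) = inner ℂ v (B v) := by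
  rw [reApplyInnerSelf_apply, ← hB.isSymmetric.apply_clm v v]
  exact hB.isSymmetric.coe_re_inner_apply_self v

theorem norm_inner_apply_sq_le {B : H →L[ℂ] H} (hB : 0 ≤ B) (w u : H) :
    ‖inner ℂ (B w) u‖ ^ 2 ≤ B.reApplyInnerSelf w * B.reApplyInnerSelf u := by
  set R := CFC.sqrt B with hR
  have hRR : R * R = B := CFC.sqrt_mul_sqrt_self B hB
  have hRs : IsSelfAdjoint R := IsSelfAdjoint.of_nonneg (CFC.sqrt_nonneg B)
  have key : ∀ x y, inner ℂ (B x) y = inner ℂ (R x) (R y) := fun x y => by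
    rw [← hRR, mul_apply_eq_comp, ← adjoint_inner_right, ← star_eq_adjoint, hRs.star_eq]
  have h1 : ∀ x, B.reApplyInnerSelf x = ‖R x‖ ^ 2 := fun x => by
    rw [reApplyInnerSelf_apply, key, inner_self_eq_norm_sq_to_K]
    norm_cast
  rw [key, h1, h1, ← mul_pow]
  gcongr
  exact norm_inner_le_norm _ _

theorem IsStrictlyPositive.reApplyInnerSelf_pos {B : H →L[ℂ] H} (hB : IsStrictlyPositive B)
    {v : H} (hv : v ≠ 0) : 0 < B.reApplyInnerSelf v := by
  obtain ⟨c, hc, h⟩ := hB.exists_smul_one_le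
  have h1 := reApplyInnerSelf_mono h v
  rw [reApplyInnerSelf_real_smul, reApplyInnerSelf_one] at h1
  have : 0 < ‖v‖ := norm_pos_iff.2 hv
  exact lt_of_lt_of_le (by positivity) h1

/-- This turns the quadratic form of `B⁻¹` into an order relation for `B`, to which monotonicity of
a mean applies. One direction tests the inequality at `B⁻¹ v`; the other is Cauchy–Schwarz for the
form of `B`. -/
theorem smul_rankOne_le_iff {B : H →L[ℂ] H} (hB : IsStrictlyPositive B) {c : ℝ} (hc : 0 ≤ c)
    {v : H} (hv : v ≠ 0) :
    c • rankOne ℂ v v ≤ B ↔ c * (Ring.inverse B).reApplyInnerSelf v ≤ 1 := by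
  have hpos := hB.ringInverse.reApplyInnerSelf_pos hv
  constructor
  · intro h
    have h1 := reApplyInnerSelf_mono h (Ring.inverse B v)
    rw [reApplyInnerSelf_real_smul, reApplyInnerSelf_rankOne,
      ← reApplyInnerSelf_ringInverse hB.isUnit,
      ← ofReal_reApplyInnerSelf hB.ringInverse.isSelfAdjoint, Complex.norm_real,
      Real.norm_eq_abs, sq_abs] at h1
    nlinarith
  · intro h
    refine le_of_reApplyInnerSelf_le ?_ hB.isSelfAdjoint fun u _ => ?_
    · exact (IsSelfAdjoint.all c).smul (isPositive_rankOne_self v).isSelfAdjoint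
    have h1 := norm_inner_apply_sq_le hB.nonneg (Ring.inverse B v) u
    rw [apply_ringInverse_apply hB.isUnit, ← reApplyInnerSelf_ringInverse hB.isUnit] at h1
    rw [reApplyInnerSelf_real_smul, reApplyInnerSelf_rankOne]
    have h2 : 0 ≤ B.reApplyInnerSelf u :=
      ((nonneg_iff_isPositive B).1 hB.nonneg).re_inner_nonneg_left u
    calc c * ‖inner ℂ v u‖ ^ 2
        ≤ c * ((Ring.inverse B).reApplyInnerSelf v * B.reApplyInnerSelf u) := by gcongr
      _ = (c * (Ring.inverse B).reApplyInnerSelf v) * B.reApplyInnerSelf u := by ring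
      _ ≤ 1 * B.reApplyInnerSelf u := by gcongr
      _ = _ := one_mul _

theorem rankOne_mul_mul_rankOne {B : H →L[ℂ] H} (hB : IsSelfAdjoint B) (v : H) :
    rankOne ℂ v v * B * rankOne ℂ v v = B.reApplyInnerSelf v • rankOne ℂ v v := by
  ext w
  rw [_root_.smul_apply, ← Complex.coe_smul, ofReal_reApplyInnerSelf hB]
  simp [smul_smul, mul_comm]

end RankOne

/-! ### Two-variable means on scalars, projections and rank-one compressions. -/

namespace IsOperatorMean

open ContinuousLinearMap InnerProductSpace

variable {H : Type*} [NormedAddCommGroup H] [InnerProductSpace ℂ H] [CompleteSpace H]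
  {s : (H →L[ℂ] H) → (H →L[ℂ] H) → (H →L[ℂ] H)}

/-- The reverse inequality is the transformer inequality for `C⁻¹`, conjugated back by `C`. -/
theorem conj_eq (hs : IsOperatorMean s) {A B C : H →L[ℂ] H} (hA : 0 ≤ A) (hB : 0 ≤ B)
    (hC : IsStrictlyPositive C) : C * s A B * C = s (C * A * C) (C * B * C) := by
  refine le_antisymm (hs.transformer A B C hA hB hC.nonneg) ?_
  set D := Ring.inverse C
  have h1 : D * C = 1 := Ring.inverse_mul_cancel C hC.isUnit
  have h2 : C * D = 1 := Ring.mul_inverse_cancel C hC.isUnit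
  have key : ∀ X, D * (C * X * C) * D = X := fun X => by
    rw [show D * (C * X * C) * D = (D * C) * X * (C * D) by noncomm_ring, h1, h2, one_mul, mul_one]
  have key' : ∀ X, C * (D * X * D) * C = X := fun X => by
    rw [show C * (D * X * D) * C = (C * D) * X * (D * C) by noncomm_ring, h1, h2, one_mul, mul_one]
  have h3 := hs.transformer (C * A * C) (C * B * C) D
    (conjugate_nonneg_of_nonneg hA hC.nonneg) (conjugate_nonneg_of_nonneg hB hC.nonneg)
    hC.ringInverse.nonneg
  rw [key, key] at h3
  have h4 := conjugate_le_conjugate_of_nonneg h3 hC.nonneg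
  rwa [key'] at h4

theorem smul_one_self (hs : IsOperatorMean s) {c : ℝ} (hc : 0 < c) :
    s (c • 1) (c • 1) = c • (1 : H →L[ℂ] H) := by
  have h := hs.conj_eq (A := 1) (B := 1) (C := √c • 1) zero_le_one zero_le_one
    (isStrictlyPositive_one.smul (Real.sqrt_pos.2 hc))
  simpa [hs.normalized, smul_smul, Real.mul_self_sqrt hc.le] using h.symm

theorem isStrictlyPositive (hs : IsOperatorMean s) {A B : H →L[ℂ] H} (hA : IsStrictlyPositive A)
    (hB : IsStrictlyPositive B) : IsStrictlyPositive (s A B) := by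
  obtain ⟨a, ha, hA'⟩ := hA.exists_smul_one_le
  obtain ⟨b, hb, hB'⟩ := hB.exists_smul_one_le
  have hc : 0 < min a b := lt_min ha hb
  refine IsStrictlyPositive.of_smul_one_le hc ?_
  rw [← hs.smul_one_self hc]
  refine hs.mono _ _ _ _ (smul_nonneg hc.le zero_le_one) (smul_nonneg hc.le zero_le_one)
    (le_trans ?_ hA') (le_trans ?_ hB')
  · exact smul_le_smul_of_nonneg_right (min_le_left _ _) zero_le_one
  · exact smul_le_smul_of_nonneg_right (min_le_right _ _) zero_le_one

variable {f : ℝ → ℝ}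

theorem smul_proj_le (hs : IsOperatorMean s)
    (hf : ∀ x : ℝ, 0 < x → s 1 (x • 1) = f x • (1 : H →L[ℂ] H)) {P : H →L[ℂ] H}
    (hP : IsStarProjection P) {x : ℝ} (hx : 0 < x) : f x • P ≤ s P (x • P) := by
  have h := hs.transformer 1 (x • 1) P zero_le_one (smul_nonneg hx.le zero_le_one) hP.nonneg
  simpa [hf x hx, hP.isIdempotentElem.eq] using h

theorem proj_le_smul_one (hs : IsOperatorMean s)
    (hf : ∀ x : ℝ, 0 < x → s 1 (x • 1) = f x • (1 : H →L[ℂ] H)) {P : H →L[ℂ] H}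
    (hP : IsStarProjection P) {x : ℝ} (hx : 0 < x) : s P (x • P) ≤ f x • 1 := by
  rw [← hf x hx]
  exact hs.mono _ _ _ _ hP.nonneg (smul_nonneg hx.le hP.nonneg) hP.le_one
    (smul_le_smul_of_nonneg_left hP.le_one hx.le)

/-- The Jensen inequality for the quadratic form of `I σ B`. -/
theorem reApplyInnerSelf_le (hs : IsOperatorMean s)
    (hf : ∀ x : ℝ, 0 < x → s 1 (x • 1) = f x • (1 : H →L[ℂ] H)) {B : H →L[ℂ] H}
    (hB : IsStrictlyPositive B) {v : H} (hv : ‖v‖ = 1) :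
    (s 1 B).reApplyInnerSelf v ≤ f (B.reApplyInnerSelf v) := by
  have hv0 : v ≠ 0 := fun h => by simp [h] at hv
  have hP : IsStarProjection (rankOne ℂ v v) := isStarProjection_rankOne_self hv
  -- Compression by `P = |v⟩⟨v|` replaces `B` by `b P` with `b = ⟨B v, v⟩`, and `P σ (b P) ≤ f(b)
  -- I`.
  have h := (hs.transformer 1 B _ zero_le_one hB.nonneg hP.nonneg)
  rw [rankOne_mul_mul_rankOne (IsSelfAdjoint.of_nonneg (hs.nonneg _ _ zero_le_one hB.nonneg)),
    rankOne_mul_mul_rankOne hB.isSelfAdjoint, mul_one, hP.isIdempotentElem.eq] at h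
  have h1 := reApplyInnerSelf_mono
    (h.trans (hs.proj_le_smul_one hf hP (hB.reApplyInnerSelf_pos hv0))) v
  rw [reApplyInnerSelf_real_smul, reApplyInnerSelf_real_smul, reApplyInnerSelf_rankOne,
    reApplyInnerSelf_one, inner_self_eq_norm_sq_to_K] at h1
  simpa [hv] using h1

/-- The Jensen inequality for the quadratic form of `(I σ B)⁻¹`. -/
theorem reApplyInnerSelf_ringInverse_le (hs : IsOperatorMean s)
    (hf : ∀ x : ℝ, 0 < x → s 1 (x • 1) = f x • (1 : H →L[ℂ] H)) (hf0 : ∀ x, 0 < x → 0 < f x)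
    {B : H →L[ℂ] H} (hB : IsStrictlyPositive B) {v : H} (hv : ‖v‖ = 1) :
    (Ring.inverse (s 1 B)).reApplyInnerSelf v ≤
      (f ((Ring.inverse B).reApplyInnerSelf v)⁻¹)⁻¹ := by
  have hv0 : v ≠ 0 := fun h => by simp [h] at hv
  have hP : IsStarProjection (rankOne ℂ v v) := isStarProjection_rankOne_self hv
  have hb := hB.ringInverse.reApplyInnerSelf_pos hv0
  set b := (Ring.inverse B).reApplyInnerSelf v
  have hb' : 0 < b⁻¹ := inv_pos.2 hb
  -- `b⁻¹` is the largest multiple of `|v⟩⟨v|` below `B`; by monotonicity `f(b⁻¹) |v⟩⟨v| ≤ I σ B`,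
  -- and the same criterion translates this back to the inverse.
  have h1 : b⁻¹ • rankOne ℂ v v ≤ B :=
    (smul_rankOne_le_iff hB hb'.le hv0).2 (inv_mul_cancel₀ hb.ne').le
  have h2 : f b⁻¹ • rankOne ℂ v v ≤ s 1 B := (hs.smul_proj_le hf hP hb').trans
    (hs.mono _ _ _ _ hP.nonneg (smul_nonneg hb'.le hP.nonneg) hP.le_one h1)
  have h3 := (smul_rankOne_le_iff (hs.isStrictlyPositive isStrictlyPositive_one hB)
    (hf0 _ hb').le hv0).1 h2
  rwa [← one_div, le_div_iff₀ (hf0 _ hb'), mul_comm]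

/-- The difference `S = I σ B - f(x) P` is nonnegative, while the transformer inequality gives `P S
P ≤ 0`. So `P S P = 0`, hence `√S P = 0` and `S P = 0`. -/
theorem mul_proj_eq (hs : IsOperatorMean s)
    (hf : ∀ x : ℝ, 0 < x → s 1 (x • 1) = f x • (1 : H →L[ℂ] H)) {P B : H →L[ℂ] H}
    (hP : IsStarProjection P) {x : ℝ} (hx : 0 < x) (hPB : P * B * P = x • P) (hB : x • P ≤ B) :
    s 1 B * P = f x • P := by
  have hB0 : 0 ≤ B := (smul_nonneg hx.le hP.nonneg).trans hB
  have hPP := hP.isIdempotentElem.eq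
  have h1 : 0 ≤ s 1 B - f x • P := sub_nonneg.2 <| (hs.smul_proj_le hf hP hx).trans
    (hs.mono _ _ _ _ hP.nonneg (smul_nonneg hx.le hP.nonneg) hP.le_one hB)
  have h2 := hs.transformer 1 B P zero_le_one hB0 hP.nonneg
  rw [hPB, mul_one, hPP] at h2
  have h3 := conjugate_le_conjugate_of_nonneg (h2.trans (hs.proj_le_smul_one hf hP hx)) hP.nonneg
  rw [show P * (P * s 1 B * P) * P = (P * P) * s 1 B * (P * P) by noncomm_ring, hPP] at h3
  have h4 : P * (s 1 B - f x • P) * P ≤ 0 := by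
    rw [mul_sub, sub_mul, sub_nonpos]
    simpa [hPP] using h3
  set S := s 1 B - f x • P with hS
  have h5 : P * S * P = 0 := le_antisymm h4 (conjugate_nonneg_of_nonneg h1 hP.nonneg)
  have h6 : CFC.sqrt S * P = 0 := by
    rw [← CStarRing.star_mul_self_eq_zero_iff, star_mul, hP.isSelfAdjoint.star_eq,
      (IsSelfAdjoint.of_nonneg (CFC.sqrt_nonneg S)).star_eq, mul_assoc, ← mul_assoc (CFC.sqrt S),
      CFC.sqrt_mul_sqrt_self S h1, ← mul_assoc, h5]
  have h7 : S * P = 0 := by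
    rw [← CFC.sqrt_mul_sqrt_self S h1, mul_assoc, h6, mul_zero]
  rw [hS, sub_mul, sub_eq_zero, smul_mul_assoc, hPP] at h7
  exact h7

/-- Apply `mul_proj_eq` to `P` and to `1 - P` and add. -/
theorem one_smul_proj_add (hs : IsOperatorMean s)
    (hf : ∀ x : ℝ, 0 < x → s 1 (x • 1) = f x • (1 : H →L[ℂ] H)) {P : H →L[ℂ] H}
    (hP : IsStarProjection P) {x y : ℝ} (hx : 0 < x) (hy : 0 < y) :
    s 1 (x • P + y • (1 - P)) = f x • P + f y • (1 - P) := by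
  have hQ := hP.one_sub
  have hPP := hP.isIdempotentElem.eq
  have h1 := hs.mul_proj_eq hf hP (B := x • P + y • (1 - P)) hx
    (by simp [mul_add, mul_sub, hPP])
    (le_add_of_nonneg_right (smul_nonneg hy.le hQ.nonneg))
  have h2 := hs.mul_proj_eq hf hQ (B := x • P + y • (1 - P)) hy
    (by simp [mul_add, mul_sub, sub_mul, hPP])
    (le_add_of_nonneg_left (smul_nonneg hx.le hP.nonneg))
  rw [← h1, ← h2, ← mul_add, add_sub_cancel, mul_one]

end IsOperatorMean

/-! ### Tangent lines at `1` for scalar functions. -/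

section Scalar

/-- By `hJ`, chord slopes from `1` to the right never exceed those to the left; `α` is the supremum
of the right ones. It is positive because `g` exceeds `1` somewhere beyond `1`. -/
theorem exists_slope_of_jensen_at_one {g : ℝ → ℝ}
    (hJ : ∀ x y, 0 < x → x < 1 → 1 < y → (y - 1) * g x + (1 - x) * g y ≤ y - x)
    (h1 : g 1 = 1) (hgt : ∃ x, 1 < x ∧ 1 < g x) :
    ∃ α, 0 < α ∧ ∀ x, 0 < x → g x ≤ 1 + α * (x - 1) := by
  have hb : ∀ x y, 0 < x → x < 1 → 1 < y → (g y - 1) / (y - 1) ≤ (1 - g x) / (1 - x) := by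
    intro x y hx hx1 hy
    rw [div_le_div_iff₀ (by linarith) (by linarith)]
    linarith [hJ x y hx hx1 hy]
  set S : Set ℝ := (fun y => (g y - 1) / (y - 1)) '' Set.Ioi 1
  have hbdd : BddAbove S := by
    refine ⟨(1 - g (1 / 2)) / (1 - 1 / 2), ?_⟩
    rintro _ ⟨y, hy, rfl⟩
    exact hb _ _ (by norm_num) (by norm_num) hy
  have hle : ∀ y, 1 < y → (g y - 1) / (y - 1) ≤ sSup S := fun y hy => le_csSup hbdd ⟨y, hy, rfl⟩
  obtain ⟨x₀, hx₀, hgx₀⟩ := hgt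
  refine ⟨sSup S, lt_of_lt_of_le (div_pos (by linarith) (by linarith)) (hle x₀ hx₀),
    fun x hx => ?_⟩
  rcases lt_trichotomy x 1 with hx1 | rfl | hx1
  · have : sSup S ≤ (1 - g x) / (1 - x) := by
      refine csSup_le ⟨_, x₀, hx₀, rfl⟩ ?_
      rintro _ ⟨y, hy, rfl⟩
      exact hb x y hx hx1 hy
    rw [le_div_iff₀ (by linarith)] at this
    linarith
  · simp [h1]
  · have := hle x hx1
    rw [div_le_iff₀ (by linarith)] at this
    linarith

/-- This makes the slope strictly positive. If `g` never exceeds `1`, then `g = 1` on `[1, ∞)`, so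
`h(1/2) = 1`; the Jensen inequality forces `h ≤ 1` beyond `1`, that is `g ≥ 1` below `1`, and
monotonicity makes `g` constant. -/
theorem exists_one_lt_of_jensen_at_one {g h : ℝ → ℝ} (hg : MonotoneOn g (Set.Ioi 0))
    (hh : ∀ x, 0 < x → 0 < h x) (hgh : ∀ x, 0 < x → g x = (h x⁻¹)⁻¹)
    (hJ : ∀ x y, 0 < x → x < 1 → 1 < y → (y - 1) * h x + (1 - x) * h y ≤ y - x)
    (h1 : g 1 = 1) (hne : ∃ x, 0 < x ∧ g x ≠ 1) : ∃ x, 1 < x ∧ 1 < g x := by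
  by_contra! hcon
  have hge : ∀ x, 1 ≤ x → g x = 1 := by
    intro x hx
    have h0 : 1 ≤ g x := h1 ▸ hg (by simp) (show (0 : ℝ) < x by linarith) hx
    rcases hx.eq_or_lt with rfl | hx
    · exact h1
    · exact le_antisymm (hcon x hx) h0
  have hhalf : h (1 / 2) = 1 := by
    have := hge 2 (by norm_num)
    rw [hgh 2 (by norm_num)] at this
    simpa using this
  obtain ⟨x, hx, hx1⟩ := hne
  rcases le_or_gt 1 x with hle | hlt
  · exact hx1 (hge x hle)
  have hx' : 1 < x⁻¹ := (one_lt_inv₀ hx).2 hlt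
  have h2 := hJ (1 / 2) x⁻¹ (by norm_num) (by norm_num) hx'
  rw [hhalf] at h2
  have h3 : h x⁻¹ ≤ 1 := by linarith
  apply hx1
  refine le_antisymm (h1 ▸ hg hx (by simp) hlt.le) ?_
  rw [hgh x hx]
  exact (one_le_inv₀ (hh _ (inv_pos.2 hx))).2 h3

end Scalar

/-! ### Concavity at `1` of the representing function, tested on a two-dimensional space. -/

open ContinuousLinearMap InnerProductSpace

theorem reApplyInnerSelf_smul_proj_add {H : Type*} [NormedAddCommGroup H]
    [InnerProductSpace ℂ H] (P : H →L[ℂ] H) (x y : ℝ) {v : H}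
    (hv : ‖v‖ = 1) :
    (x • P + y • (1 - P)).reApplyInnerSelf v =
      x * P.reApplyInnerSelf v + y * (1 - P.reApplyInnerSelf v) := by
  rw [reApplyInnerSelf_add, reApplyInnerSelf_real_smul, reApplyInnerSelf_real_smul,
    reApplyInnerSelf_sub, reApplyInnerSelf_one, hv, one_pow]

/-- Since `f` does not depend on the space, its scalar properties can be read off on `ℂ²`, even if
the given space is trivial. `ULift` places `ℂ²` in the universe on which `σ` acts. -/
theorem exists_isStarProjection_reApplyInnerSelf_eq {t : ℝ} (h0 : 0 ≤ t) (h1 : t ≤ 1) :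
    ∃ (P : EuclideanSpace ℂ (ULift.{u} (Fin 2)) →L[ℂ] EuclideanSpace ℂ (ULift.{u} (Fin 2)))
      (v : EuclideanSpace ℂ (ULift.{u} (Fin 2))),
      IsStarProjection P ∧ ‖v‖ = 1 ∧ P.reApplyInnerSelf v = t := by
  let p : EuclideanSpace ℂ (ULift.{u} (Fin 2)) := EuclideanSpace.single ⟨0⟩ 1
  let v : EuclideanSpace ℂ (ULift.{u} (Fin 2)) :=
    WithLp.toLp 2 fun i => if i.down = 0 then (√t : ℂ) else (√(1 - t) : ℂ)
  refine ⟨rankOne ℂ p p, v, isStarProjection_rankOne_self (by simp [p]), ?_, ?_⟩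
  · have hsum : ∑ i, ‖v i‖ ^ 2 = 1 := by
      rw [← Equiv.sum_comp Equiv.ulift.symm]
      simp [v, Real.sq_sqrt h0, Real.sq_sqrt (sub_nonneg.2 h1)]
    rw [EuclideanSpace.norm_eq, hsum, Real.sqrt_one]
  · rw [reApplyInnerSelf_rankOne]
    simp [p, v, EuclideanSpace.inner_single_left, Real.sq_sqrt h0]

namespace IsOperatorMean

section

variable {H : Type*} [NormedAddCommGroup H] [InnerProductSpace ℂ H] [CompleteSpace H]
  {s : (H →L[ℂ] H) → (H →L[ℂ] H) → (H →L[ℂ] H)} {f : ℝ → ℝ}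

theorem representing_pos [Nontrivial H] (hs : IsOperatorMean s)
    (hf : ∀ x : ℝ, 0 < x → s 1 (x • 1) = f x • (1 : H →L[ℂ] H)) {x : ℝ} (hx : 0 < x) :
    0 < f x := by
  obtain ⟨v, hv⟩ := exists_ne (0 : H)
  have h := (hs.isStrictlyPositive isStrictlyPositive_one
    (isStrictlyPositive_one.smul hx)).reApplyInnerSelf_pos hv
  rw [hf x hx, reApplyInnerSelf_real_smul, reApplyInnerSelf_one] at h
  exact pos_of_mul_pos_left h (by positivity)

theorem representing_monotoneOn [Nontrivial H] (hs : IsOperatorMean s)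
    (hf : ∀ x : ℝ, 0 < x → s 1 (x • 1) = f x • (1 : H →L[ℂ] H)) :
    MonotoneOn f (Set.Ioi 0) := by
  intro x hx y hy hxy
  obtain ⟨v, hv⟩ := exists_ne (0 : H)
  have h := reApplyInnerSelf_mono (hs.mono 1 (x • 1) 1 (y • 1) zero_le_one
    (smul_nonneg (le_of_lt hx) zero_le_one) le_rfl
    (smul_le_smul_of_nonneg_right hxy zero_le_one)) v
  rw [hf x hx, hf y hy, reApplyInnerSelf_real_smul, reApplyInnerSelf_real_smul,
    reApplyInnerSelf_one] at h
  have : 0 < ‖v‖ := norm_pos_iff.2 hv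
  exact le_of_mul_le_mul_right h (by positivity)

theorem representing_one [Nontrivial H] (hs : IsOperatorMean s)
    (hf : ∀ x : ℝ, 0 < x → s 1 (x • 1) = f x • (1 : H →L[ℂ] H)) : f 1 = 1 := by
  have h := hf 1 one_pos
  rw [one_smul, hs.normalized] at h
  have h2 : (1 - f 1) • (1 : H →L[ℂ] H) = 0 := by rw [sub_smul, one_smul, ← h, sub_self]
  linarith [(smul_eq_zero.1 h2).resolve_right one_ne_zero]

theorem isStrictlyPositive_smul_proj_add {P : H →L[ℂ] H} (hP : IsStarProjection P) {x y : ℝ}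
    (hx : 0 < x) (hy : 0 < y) : IsStrictlyPositive (x • P + y • (1 - P)) ∧
      Ring.inverse (x • P + y • (1 - P)) = x⁻¹ • P + y⁻¹ • (1 - P) := by
  have hPP := hP.isIdempotentElem.eq
  have key : ∀ {a b : ℝ}, 0 < a → 0 < b →
      (a • P + b • (1 - P)) * (a⁻¹ • P + b⁻¹ • (1 - P)) = 1 := by
    intro a b ha hb
    simp [mul_add, mul_sub, sub_mul, add_mul, hPP, smul_smul, ha.ne', hb.ne']
  have h1 := key hx hy
  have h2 := key (inv_pos.2 hx) (inv_pos.2 hy)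
  rw [inv_inv, inv_inv] at h2
  refine ⟨IsUnit.isStrictlyPositive ⟨⟨_, _, h1, h2⟩, rfl⟩ ?_, ringInverse_eq_of_mul_eq_one h1 h2⟩
  exact add_nonneg (smul_nonneg hx.le hP.nonneg) (smul_nonneg hy.le hP.one_sub.nonneg)

end

section

variable {s : (EuclideanSpace ℂ (ULift.{u} (Fin 2)) →L[ℂ] EuclideanSpace ℂ (ULift.{u} (Fin 2))) →
    (EuclideanSpace ℂ (ULift.{u} (Fin 2)) →L[ℂ] EuclideanSpace ℂ (ULift.{u} (Fin 2))) →
    (EuclideanSpace ℂ (ULift.{u} (Fin 2)) →L[ℂ] EuclideanSpace ℂ (ULift.{u} (Fin 2)))}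
  {f : ℝ → ℝ}

theorem representing_jensen_at_one (hs : IsOperatorMean s)
    (hf : ∀ x : ℝ, 0 < x → s 1 (x • 1) = f x • 1) {x y : ℝ} (hx : 0 < x) (hx1 : x < 1)
    (hy : 1 < y) : (y - 1) * f x + (1 - x) * f y ≤ y - x := by
  have hyx : 0 < y - x := by linarith
  -- This weight `t` solves `t x + (1 - t) y = 1`, so the form of `x P + y (1 - P)` at `v` equals
  -- `1`.
  obtain ⟨P, v, hP, hv, ht⟩ := exists_isStarProjection_reApplyInnerSelf_eq.{u}
    (t := (y - 1) / (y - x)) (div_nonneg (by linarith) hyx.le)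
    ((div_le_one hyx).2 (by linarith))
  have h := hs.reApplyInnerSelf_le hf (isStrictlyPositive_smul_proj_add hP hx
    (by linarith : 0 < y)).1 hv
  rw [hs.one_smul_proj_add hf hP hx (by linarith), reApplyInnerSelf_smul_proj_add _ _ _ hv,
    reApplyInnerSelf_smul_proj_add _ _ _ hv, ht,
    show x * ((y - 1) / (y - x)) + y * (1 - (y - 1) / (y - x)) = 1 by field_simp; ring,
    hs.representing_one hf] at h
  rw [show f x * ((y - 1) / (y - x)) + f y * (1 - (y - 1) / (y - x)) =
    ((y - 1) * f x + (1 - x) * f y) / (y - x) by field_simp; ring, div_le_one hyx] at h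
  exact h

theorem representing_inv_jensen_at_one (hs : IsOperatorMean s)
    (hf : ∀ x : ℝ, 0 < x → s 1 (x • 1) = f x • 1) {x y : ℝ} (hx : 0 < x) (hx1 : x < 1)
    (hy : 1 < y) : (y - 1) * (f x⁻¹)⁻¹ + (1 - x) * (f y⁻¹)⁻¹ ≤ y - x := by
  have hyx : 0 < y - x := by linarith
  have hx' : 0 < x⁻¹ := inv_pos.2 hx
  have hy' : 0 < y⁻¹ := inv_pos.2 (by linarith)
  have hpos := fun z hz => hs.representing_pos hf (x := z) hz
  obtain ⟨P, v, hP, hv, ht⟩ := exists_isStarProjection_reApplyInnerSelf_eq.{u}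
    (t := (y - 1) / (y - x)) (div_nonneg (by linarith) hyx.le)
    ((div_le_one hyx).2 (by linarith))
  -- The test operator has eigenvalues `x⁻¹` and `y⁻¹`, so it is its inverse whose form at `v`
  -- equals `1`.
  have hB := isStrictlyPositive_smul_proj_add hP hx' hy'
  have h := hs.reApplyInnerSelf_ringInverse_le hf hpos hB.1 hv
  rw [hs.one_smul_proj_add hf hP hx' hy', hB.2, inv_inv, inv_inv,
    (isStrictlyPositive_smul_proj_add hP (hpos _ hx') (hpos _ hy')).2,
    reApplyInnerSelf_smul_proj_add _ _ _ hv, reApplyInnerSelf_smul_proj_add _ _ _ hv, ht,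
    show x * ((y - 1) / (y - x)) + y * (1 - (y - 1) / (y - x)) = 1 by field_simp; ring,
    inv_one, hs.representing_one hf, inv_one] at h
  rw [show (f x⁻¹)⁻¹ * ((y - 1) / (y - x)) + (f y⁻¹)⁻¹ * (1 - (y - 1) / (y - x)) =
    ((y - 1) * (f x⁻¹)⁻¹ + (1 - x) * (f y⁻¹)⁻¹) / (y - x) by
      generalize (f x⁻¹)⁻¹ = a; generalize (f y⁻¹)⁻¹ = b; field_simp; ring, div_le_one hyx] at h
  exact h

end

/-! ### Affine operator bounds, and the left trivial case. -/

section

variable {H : Type*} [NormedAddCommGroup H] [InnerProductSpace ℂ H] [CompleteSpace H]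
  {s : (H →L[ℂ] H) → (H →L[ℂ] H) → (H →L[ℂ] H)} {f : ℝ → ℝ}

theorem eq_conjSqrt (hs : IsOperatorMean s) {A B : H →L[ℂ] H} (hA : IsStrictlyPositive A)
    (hB : IsStrictlyPositive B) :
    s A B = CFC.conjSqrt A (s 1 (CFC.conjSqrt (Ring.inverse A) B)) := by
  have hB' := (CFC.isStrictlyPositive_conjSqrt_iff _ B hA.ringInverse).2 hB
  have h := hs.conj_eq (A := 1) zero_le_one hB'.nonneg hA.sqrt
  rw [CFC.conjSqrt_apply, h, ← CFC.conjSqrt_apply, ← CFC.conjSqrt_apply,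
    CFC.conjSqrt_one A hA.nonneg, CFC.conjSqrt_conjSqrt_ringInverse A B hA]

/-- Jensen and the tangent line settle `A = I`; conjugation by `√A` gives the general case. -/
theorem le_affine (hs : IsOperatorMean s)
    (hf : ∀ x : ℝ, 0 < x → s 1 (x • 1) = f x • (1 : H →L[ℂ] H)) {α : ℝ}
    (hα : ∀ x, 0 < x → f x ≤ 1 + α * (x - 1)) {A B : H →L[ℂ] H} (hA : IsStrictlyPositive A)
    (hB : IsStrictlyPositive B) : s A B ≤ (1 - α) • A + α • B := by
  have hB' := (CFC.isStrictlyPositive_conjSqrt_iff _ B hA.ringInverse).2 hB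
  have h1 : ∀ C : H →L[ℂ] H, IsStrictlyPositive C → s 1 C ≤ (1 - α) • 1 + α • C := by
    intro C hC
    refine le_of_reApplyInnerSelf_le
      (hs.isStrictlyPositive isStrictlyPositive_one hC).isSelfAdjoint
      (((IsSelfAdjoint.all _).smul (.one _)).add ((IsSelfAdjoint.all _).smul hC.isSelfAdjoint))
      fun v hv => ?_
    have hv0 : v ≠ 0 := fun h => by simp [h] at hv
    have h2 := (hs.reApplyInnerSelf_le hf hC hv).trans (hα _ (hC.reApplyInnerSelf_pos hv0))
    rw [reApplyInnerSelf_add, reApplyInnerSelf_real_smul, reApplyInnerSelf_real_smul,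
      reApplyInnerSelf_one, hv]
    linarith
  have h3 := CFC.conjSqrt_le_conjSqrt (c := A) (h1 _ hB')
  rwa [← hs.eq_conjSqrt hA hB, map_add, map_smul, map_smul, CFC.conjSqrt_one A hA.nonneg,
    CFC.conjSqrt_conjSqrt_ringInverse A B hA] at h3

theorem ringInverse_le_affine (hs : IsOperatorMean s)
    (hf : ∀ x : ℝ, 0 < x → s 1 (x • 1) = f x • (1 : H →L[ℂ] H)) (hf0 : ∀ x, 0 < x → 0 < f x)
    {β : ℝ} (hβ : ∀ x, 0 < x → (f x⁻¹)⁻¹ ≤ 1 + β * (x - 1)) {A B : H →L[ℂ] H}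
    (hA : IsStrictlyPositive A) (hB : IsStrictlyPositive B) :
    Ring.inverse (s A B) ≤ (1 - β) • Ring.inverse A + β • Ring.inverse B := by
  have hB' := (CFC.isStrictlyPositive_conjSqrt_iff _ B hA.ringInverse).2 hB
  have h1 : ∀ C : H →L[ℂ] H, IsStrictlyPositive C →
      Ring.inverse (s 1 C) ≤ (1 - β) • 1 + β • Ring.inverse C := by
    intro C hC
    have hC' := hC.ringInverse
    refine le_of_reApplyInnerSelf_le
      (hs.isStrictlyPositive isStrictlyPositive_one hC).ringInverse.isSelfAdjoint
      (((IsSelfAdjoint.all _).smul (.one _)).add ((IsSelfAdjoint.all _).smul hC'.isSelfAdjoint))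
      fun v hv => ?_
    have hv0 : v ≠ 0 := fun h => by simp [h] at hv
    have h2 := (hs.reApplyInnerSelf_ringInverse_le hf hf0 hC hv).trans
      (hβ _ (hC'.reApplyInnerSelf_pos hv0))
    rw [reApplyInnerSelf_add, reApplyInnerSelf_real_smul, reApplyInnerSelf_real_smul,
      reApplyInnerSelf_one, hv]
    linarith
  have h3 := CFC.conjSqrt_le_conjSqrt (c := Ring.inverse A) (h1 _ hB')
  rwa [← CFC.ringInverse_conjSqrt A _ hA, ← hs.eq_conjSqrt hA hB, map_add, map_smul, map_smul,
    CFC.conjSqrt_one _ hA.ringInverse.nonneg, ← CFC.ringInverse_conjSqrt A _ hA,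
    CFC.conjSqrt_conjSqrt_ringInverse A B hA] at h3

theorem decreasesTo_add_smul_one (A : H →L[ℂ] H) :
    DecreasesTo (fun k : ℕ => A + ((k : ℝ) + 1)⁻¹ • 1) A := by
  refine ⟨fun j k hjk => ?_, fun v => ?_⟩
  · refine add_le_add le_rfl (smul_le_smul_of_nonneg_right ?_ zero_le_one)
    gcongr
  · have h : Tendsto (fun k : ℕ => ((k : ℝ) + 1)⁻¹) atTop (𝓝 0) := by
      simpa [one_div] using tendsto_one_div_add_atTop_nhds_zero_nat (𝕜 := ℝ)
    simpa using (h.smul_const v).const_add (A v)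

/-- For invertible `C`, squeezing `C` between scalars gives `I σ C = I`, hence `A σ B = A` for
invertible `A`, `B`. Downward continuity along `A + (k + 1)⁻¹ I` and `B + (k + 1)⁻¹ I` reaches all
positive operators. -/
theorem eq_left_of_representing_eq_one (hs : IsOperatorMean s)
    (hf : ∀ x : ℝ, 0 < x → s 1 (x • 1) = f x • (1 : H →L[ℂ] H)) (hf1 : ∀ x, 0 < x → f x = 1)
    {A B : H →L[ℂ] H} (hA : 0 ≤ A) (hB : 0 ≤ B) : s A B = A := by
  have hone : ∀ C : H →L[ℂ] H, IsStrictlyPositive C → s 1 C = 1 := by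
    intro C hC
    obtain ⟨a, ha, h1⟩ := hC.exists_smul_one_le
    obtain ⟨b, hb, h2⟩ := exists_le_smul_one hC.isSelfAdjoint
    refine le_antisymm ?_ ?_
    · have := hs.mono 1 C 1 (b • 1) zero_le_one hC.nonneg le_rfl h2
      rwa [hf b hb, hf1 b hb, one_smul] at this
    · have := hs.mono 1 (a • 1) 1 C zero_le_one (smul_nonneg ha.le zero_le_one) le_rfl h1
      rwa [hf a ha, hf1 a ha, one_smul] at this
  have hpos : ∀ {C : H →L[ℂ] H}, 0 ≤ C → ∀ k : ℕ,
      IsStrictlyPositive (C + ((k : ℝ) + 1)⁻¹ • 1) := fun hC k =>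
    IsStrictlyPositive.nonneg_add hC (isStrictlyPositive_one.smul (by positivity))
  have heq : ∀ k : ℕ, s (A + ((k : ℝ) + 1)⁻¹ • 1) (B + ((k : ℝ) + 1)⁻¹ • 1) =
      A + ((k : ℝ) + 1)⁻¹ • 1 := by
    intro k
    have hA' := hpos hA k
    have hB' := hpos hB k
    rw [hs.eq_conjSqrt hA' hB', hone _ ((CFC.isStrictlyPositive_conjSqrt_iff _ _
      hA'.ringInverse).2 hB'), CFC.conjSqrt_one _ hA'.nonneg]
  have hlim := hs.downward _ _ A B (fun k => (hpos hA k).nonneg) (fun k => (hpos hB k).nonneg) hA hB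
    (decreasesTo_add_smul_one A) (decreasesTo_add_smul_one B)
  simp only [heq] at hlim
  ext v
  exact tendsto_nhds_unique (hlim.2 v) ((decreasesTo_add_smul_one A).2 v)

end

end IsOperatorMean

/-- A mean other than the left trivial one lies between a weighted harmonic and a weighted
arithmetic mean of positive weights. -/
theorem OperatorMean.exists_affine_bounds (σ : OperatorMean.{u}) (hσ : ¬ σ.IsLeftTrivial) :
    ∃ α β : ℝ, 0 < α ∧ 0 < β ∧ ∀ (H : Type u) [NormedAddCommGroup H] [InnerProductSpace ℂ H]
      [CompleteSpace H] (A B : H →L[ℂ] H), IsStrictlyPositive A → IsStrictlyPositive B →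
      σ.op H A B ≤ (1 - α) • A + α • B ∧
      Ring.inverse (σ.op H A B) ≤ (1 - β) • Ring.inverse A + β • Ring.inverse B := by
  obtain ⟨f, hf⟩ := σ.exists_representing
  have hE := σ.isOperatorMean (EuclideanSpace ℂ (ULift.{u} (Fin 2)))
  have hfE := hf (EuclideanSpace ℂ (ULift.{u} (Fin 2)))
  have hpos : ∀ x, 0 < x → 0 < f x := fun x hx => hE.representing_pos hfE hx
  have hmono := hE.representing_monotoneOn hfE
  have hone := hE.representing_one hfE
  have hJ : ∀ x y, 0 < x → x < 1 → 1 < y → (y - 1) * f x + (1 - x) * f y ≤ y - x :=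
    fun x y hx hx1 hy => hE.representing_jensen_at_one hfE hx hx1 hy
  have hJ' : ∀ x y, 0 < x → x < 1 → 1 < y →
      (y - 1) * (f x⁻¹)⁻¹ + (1 - x) * (f y⁻¹)⁻¹ ≤ y - x :=
    fun x y hx hx1 hy => hE.representing_inv_jensen_at_one hfE hx hx1 hy
  have hne : ∃ x, 0 < x ∧ f x ≠ 1 := by
    by_contra! h
    exact hσ fun H _ _ _ A B hA hB =>
      (σ.isOperatorMean H).eq_left_of_representing_eq_one (hf H) h hA hB
  -- The passage from `f` to `x ↦ f(x⁻¹)⁻¹` is an involution, so the two functions exchange the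
  -- roles of `g` and `h` for `α` and for `β`.
  obtain ⟨α, hα, hfα⟩ := exists_slope_of_jensen_at_one hJ hone
    (exists_one_lt_of_jensen_at_one (h := fun x => (f x⁻¹)⁻¹) hmono
      (fun x hx => inv_pos.2 (hpos _ (inv_pos.2 hx))) (fun x hx => by simp) hJ' hone hne)
  have hmono' : MonotoneOn (fun x => (f x⁻¹)⁻¹) (Set.Ioi 0) := fun x hx y hy hxy =>
    inv_anti₀ (hpos _ (inv_pos.2 hy))
      (hmono (Set.mem_Ioi.2 (inv_pos.2 hy)) (Set.mem_Ioi.2 (inv_pos.2 hx)) (inv_anti₀ hx hxy))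
  have hne' : ∃ x, 0 < x ∧ (f x⁻¹)⁻¹ ≠ 1 := by
    obtain ⟨x, hx, hfx⟩ := hne
    exact ⟨x⁻¹, inv_pos.2 hx, by simpa using hfx⟩
  obtain ⟨β, hβ, hfβ⟩ := exists_slope_of_jensen_at_one (g := fun x => (f x⁻¹)⁻¹) hJ'
    (by simp [hone])
    (exists_one_lt_of_jensen_at_one hmono' hpos (fun x hx => rfl) hJ (by simp [hone]) hne')
  exact ⟨α, β, hα, hβ, fun H _ _ _ A B hA hB =>
    ⟨(σ.isOperatorMean H).le_affine (hf H) hfα hA hB,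
      (σ.isOperatorMean H).ringInverse_le_affine (hf H) hpos hfβ hA hB⟩⟩

/-! ### Kantorovich-type comparison of arithmetic and harmonic means. -/

section Inverse

variable {H : Type*} [NormedAddCommGroup H] [InnerProductSpace ℂ H] [CompleteSpace H]

/-- Expand `(a Y - b) Y⁻¹ (a Y - b) ≥ 0`. -/
theorem two_mul_smul_one_le {Y : H →L[ℂ] H} (hY : IsStrictlyPositive Y) (a b : ℝ) :
    (2 * (a * b)) • (1 : H →L[ℂ] H) ≤ a ^ 2 • Y + b ^ 2 • Ring.inverse Y := by
  have h1 : Ring.inverse Y * Y = 1 := Ring.inverse_mul_cancel Y hY.isUnit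
  have h2 : Y * Ring.inverse Y = 1 := Ring.mul_inverse_cancel Y hY.isUnit
  have hs : IsSelfAdjoint (a • Y - b • (1 : H →L[ℂ] H)) :=
    ((IsSelfAdjoint.all a).smul hY.isSelfAdjoint).sub ((IsSelfAdjoint.all b).smul (.one _))
  have h3 := hs.conjugate_nonneg hY.ringInverse.nonneg
  rw [← sub_nonneg]
  convert h3 using 1
  simp only [sub_mul, mul_sub, smul_mul_assoc, mul_smul_comm, h1, h2, one_mul, mul_one]
  module

/-- Expand `(M - A)(A - m) A⁻¹ ≥ 0`, a product of commuting nonnegative operators. -/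
theorem add_smul_ringInverse_le {m M : ℝ} {A : H →L[ℂ] H} (hA : IsStrictlyPositive A)
    (hmA : m • (1 : H →L[ℂ] H) ≤ A) (hAM : A ≤ M • (1 : H →L[ℂ] H)) :
    A + (M * m) • Ring.inverse A ≤ (M + m) • (1 : H →L[ℂ] H) := by
  have h1 : Ring.inverse A * A = 1 := Ring.inverse_mul_cancel A hA.isUnit
  have h2 : A * Ring.inverse A = 1 := Ring.mul_inverse_cancel A hA.isUnit
  have hc1 : Commute (M • (1 : H →L[ℂ] H) - A) (A - m • 1) := by
    simp only [Commute, SemiconjBy, sub_mul, mul_sub, smul_mul_assoc, mul_smul_comm, one_mul,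
      mul_one]
    module
  have h3 : 0 ≤ (M • (1 : H →L[ℂ] H) - A) * (A - m • 1) :=
    hc1.mul_nonneg (sub_nonneg.2 hAM) (sub_nonneg.2 hmA)
  have hexp : (M • (1 : H →L[ℂ] H) - A) * (A - m • 1) = (M + m) • A - A * A - (M * m) • 1 := by
    simp only [sub_mul, mul_sub, smul_mul_assoc, mul_smul_comm, one_mul, mul_one]
    module
  have hc2 : Commute ((M • (1 : H →L[ℂ] H) - A) * (A - m • 1)) (Ring.inverse A) := by
    rw [hexp]
    simp only [Commute, SemiconjBy, sub_mul, mul_sub, smul_mul_assoc, mul_smul_comm, one_mul,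
      mul_one, h1, h2, mul_assoc]
    rw [← mul_assoc, h1, one_mul]
  have h4 := hc2.mul_nonneg h3 hA.ringInverse.nonneg
  rw [← sub_nonneg]
  convert h4 using 1
  rw [hexp]
  simp only [sub_mul, smul_mul_assoc, one_mul, mul_assoc, h2, mul_one]
  module

variable {n : ℕ} {ω : Fin n → ℝ}

theorem isStrictlyPositive_sum_smul (hω : ∀ j, 0 ≤ ω j) (hω1 : ∑ j, ω j = 1)
    {A : Fin n → H →L[ℂ] H} (hA : ∀ j, IsStrictlyPositive (A j)) :
    IsStrictlyPositive (∑ j, ω j • A j) := by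
  obtain ⟨i, -, hi⟩ := Finset.exists_ne_zero_of_sum_ne_zero (hω1 ▸ one_ne_zero : ∑ j, ω j ≠ 0)
  exact ((hA i).smul (lt_of_le_of_ne (hω i) hi.symm)).of_le
    (Finset.single_le_sum (f := fun j => ω j • A j)
      (fun j _ => smul_nonneg (hω j) (hA j).nonneg) (Finset.mem_univ i))

theorem isStrictlyPositive_harmMean (hω : ∀ j, 0 ≤ ω j) (hω1 : ∑ j, ω j = 1)
    {A : Fin n → H →L[ℂ] H} (hA : ∀ j, IsStrictlyPositive (A j)) :
    IsStrictlyPositive (harmMean ω A) :=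
  (isStrictlyPositive_sum_smul hω hω1 fun j => (hA j).ringInverse).ringInverse

theorem ringInverse_harmMean (hω : ∀ j, 0 ≤ ω j) (hω1 : ∑ j, ω j = 1)
    {A : Fin n → H →L[ℂ] H} (hA : ∀ j, IsStrictlyPositive (A j)) :
    Ring.inverse (harmMean ω A) = ∑ j, ω j • Ring.inverse (A j) :=
  Ring.inverse_inverse (isStrictlyPositive_sum_smul hω hω1 fun j => (hA j).ringInverse).isUnit

theorem arithMean_add_smul_ringInverse_harmMean_le (hω : ∀ j, 0 ≤ ω j) (hω1 : ∑ j, ω j = 1)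
    {m M : ℝ} {A : Fin n → H →L[ℂ] H} (hA : ∀ j, IsStrictlyPositive (A j))
    (hmA : ∀ j, m • (1 : H →L[ℂ] H) ≤ A j) (hAM : ∀ j, A j ≤ M • (1 : H →L[ℂ] H)) :
    arithMean ω A + (M * m) • Ring.inverse (harmMean ω A) ≤ (M + m) • (1 : H →L[ℂ] H) := by
  have h : ∑ j, ω j • (A j + (M * m) • Ring.inverse (A j)) ≤
      ∑ j, ω j • (M + m) • (1 : H →L[ℂ] H) := Finset.sum_le_sum fun j _ =>
    smul_le_smul_of_nonneg_left (add_smul_ringInverse_le (hA j) (hmA j) (hAM j)) (hω j)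
  rw [← Finset.sum_smul, hω1, one_smul] at h
  rw [ringInverse_harmMean hω hω1 hA, arithMean]
  refine le_of_eq_of_le ?_ h
  simp only [smul_add, Finset.sum_add_distrib, Finset.smul_sum, smul_comm (M * m)]

/-- The Kantorovich inequality between the weighted arithmetic and harmonic means. -/
theorem arithMean_le_smul_harmMean (hω : ∀ j, 0 ≤ ω j) (hω1 : ∑ j, ω j = 1)
    {m M : ℝ} (hm : 0 < m) (hM : 0 < M) {A : Fin n → H →L[ℂ] H}
    (hA : ∀ j, IsStrictlyPositive (A j)) (hmA : ∀ j, m • (1 : H →L[ℂ] H) ≤ A j)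
    (hAM : ∀ j, A j ≤ M • (1 : H →L[ℂ] H)) :
    arithMean ω A ≤ ((M + m) ^ 2 / (4 * M * m)) • harmMean ω A := by
  have h1 := arithMean_add_smul_ringInverse_harmMean_le hω hω1 hA hmA hAM
  have hMm : 0 < M * m := mul_pos hM hm
  have hsq : √(M * m) ^ 2 = M * m := Real.sq_sqrt hMm.le
  -- The coefficients satisfy `2ab = M + m` and `b² = M m`, so the inverse terms cancel and `a²` is
  -- the Kantorovich constant.
  have h2 := two_mul_smul_one_le (isStrictlyPositive_harmMean hω hω1 hA)
    ((M + m) / (2 * √(M * m))) √(M * m)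
  have h0 : √(M * m) ≠ 0 := (Real.sqrt_pos.2 hMm).ne'
  rw [show 2 * ((M + m) / (2 * √(M * m)) * √(M * m)) = M + m by field_simp, div_pow, mul_pow,
    hsq, show (2 : ℝ) ^ 2 * (M * m) = 4 * M * m by ring] at h2
  exact le_of_add_le_add_right (h1.trans h2)

theorem arithMean_le_harmMean_add (hω : ∀ j, 0 ≤ ω j) (hω1 : ∑ j, ω j = 1)
    {m M : ℝ} (hm : 0 < m) (hM : 0 < M) {A : Fin n → H →L[ℂ] H}
    (hA : ∀ j, IsStrictlyPositive (A j)) (hmA : ∀ j, m • (1 : H →L[ℂ] H) ≤ A j)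
    (hAM : ∀ j, A j ≤ M • (1 : H →L[ℂ] H)) :
    arithMean ω A ≤ harmMean ω A + (√M - √m) ^ 2 • (1 : H →L[ℂ] H) := by
  have h1 := arithMean_add_smul_ringInverse_harmMean_le hω hω1 hA hmA hAM
  have h2 := two_mul_smul_one_le (isStrictlyPositive_harmMean hω hω1 hA) 1 (√M * √m)
  rw [mul_pow, Real.sq_sqrt hM.le, Real.sq_sqrt hm.le, one_pow, one_smul, one_mul] at h2
  have h3 : (√M - √m) ^ 2 = (M + m) - 2 * (√M * √m) := by
    nlinarith [Real.sq_sqrt hM.le, Real.sq_sqrt hm.le]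
  rw [h3, sub_smul]
  have h4 := add_le_add h1 h2
  rw [← sub_nonneg] at h4 ⊢
  convert h4 using 1
  abel

end Inverse

/-! ### Existence of the fixed point, and its harmonic and arithmetic bounds. -/

section FixedPoint

variable {H : Type*} [NormedAddCommGroup H] [InnerProductSpace ℂ H] [CompleteSpace H]
  {n : ℕ} {𝔐 : (Fin n → H →L[ℂ] H) → (H →L[ℂ] H)}
  {s : (H →L[ℂ] H) → (H →L[ℂ] H) → (H →L[ℂ] H)}

theorem IsMultivariateMean.const_smul_one (h𝔐 : IsMultivariateMean 𝔐) {c : ℝ} (hc : 0 < c) :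
    𝔐 (fun _ => c • 1) = c • (1 : H →L[ℂ] H) := by
  have h := h𝔐.congruence (fun _ => 1) (√c • 1) (fun _ => isStrictlyPositive_one)
    (isStrictlyPositive_one.smul (Real.sqrt_pos.2 hc)).isUnit
  simpa [h𝔐.normalized, smul_smul, Real.mul_self_sqrt hc.le] using h.symm

/-- The map `F` is monotone with `m I ≤ F(m I)` and `F(M I) ≤ M I`, so its iterates from `M I`
decrease and stay above `m I`. Monotone continuity of both means shows that the strong limit is
fixed. -/
theorem IsMultivariateMean.exists_fixedPoint (h𝔐 : IsMultivariateMean 𝔐) (hs : IsOperatorMean s)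
    {m M : ℝ} (hm : 0 < m) (hmM : m ≤ M) {A : Fin n → H →L[ℂ] H}
    (hmA : ∀ j, m • (1 : H →L[ℂ] H) ≤ A j) (hAM : ∀ j, A j ≤ M • (1 : H →L[ℂ] H)) :
    ∃ X, IsStrictlyPositive X ∧ X = 𝔐 (fun j => s X (A j)) := by
  have hA := fun j => IsStrictlyPositive.of_smul_one_le hm (hmA j)
  have hM := hm.trans_le hmM
  have hm1 : 0 ≤ m • (1 : H →L[ℂ] H) := smul_nonneg hm.le zero_le_one
  set F : (H →L[ℂ] H) → (H →L[ℂ] H) := fun X => 𝔐 (fun j => s X (A j)) with hF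
  have hFmono : ∀ X Y, m • 1 ≤ X → X ≤ Y → F X ≤ F Y := by
    intro X Y hX hXY
    have hX' := IsStrictlyPositive.of_smul_one_le hm hX
    exact h𝔐.mono _ _ (fun j => hs.isStrictlyPositive hX' (hA j))
      (fun j => hs.isStrictlyPositive (hX'.of_le hXY) (hA j))
      (fun j => hs.mono _ _ _ _ hX'.nonneg (hA j).nonneg hXY le_rfl)
  have hm1' := isStrictlyPositive_one (A := H →L[ℂ] H) |>.smul hm
  have hM1' := isStrictlyPositive_one (A := H →L[ℂ] H) |>.smul hM
  have hFm : m • 1 ≤ F (m • 1) := by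
    rw [← h𝔐.const_smul_one hm]
    refine h𝔐.mono _ _ (fun _ => hm1') (fun j => ?_) fun j => ?_
    · rw [h𝔐.const_smul_one hm]; exact hs.isStrictlyPositive hm1' (hA j)
    · rw [h𝔐.const_smul_one hm]
      conv_lhs => rw [← hs.smul_one_self hm]
      exact hs.mono _ _ _ _ hm1 hm1 le_rfl (hmA j)
  have hFM : F (M • 1) ≤ M • 1 := by
    conv_rhs => rw [← h𝔐.const_smul_one hM]
    refine h𝔐.mono _ _ (fun j => hs.isStrictlyPositive hM1' (hA j)) (fun _ => hM1') fun j => ?_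
    conv_rhs => rw [← hs.smul_one_self hM]
    exact hs.mono _ _ _ _ hM1'.nonneg (hA j).nonneg le_rfl (hAM j)
  let T : ℕ → H →L[ℂ] H := fun k => F^[k] (M • 1)
  have hTs : ∀ k, T (k + 1) = F (T k) := fun k => Function.iterate_succ_apply' F k _
  have hTm : ∀ k, m • 1 ≤ T k := by
    intro k
    induction k with
    | zero => exact smul_le_smul_of_nonneg_right hmM zero_le_one
    | succ k ih => rw [hTs]; exact hFm.trans (hFmono _ _ le_rfl ih)
  have hTanti : Antitone T := by
    refine antitone_nat_of_succ_le fun k => ?_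
    induction k with
    | zero => exact hFM
    | succ k ih => rw [hTs (k + 1)]; conv_rhs => rw [hTs k]
                   exact hFmono _ _ (hTm _) ih
  obtain ⟨X, hX, hTX⟩ := exists_decreasesTo_of_antitone hTanti hTm
  have hX' := IsStrictlyPositive.of_smul_one_le hm hX
  have hT' := fun k => IsStrictlyPositive.of_smul_one_le hm (hTm k)
  refine ⟨X, hX', ?_⟩
  have hlim := h𝔐.monotone_continuity (fun k j => s (T k) (A j)) (fun j => s X (A j))
    (fun k j => hs.isStrictlyPositive (hT' k) (hA j)) (fun j => hs.isStrictlyPositive hX' (hA j))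
    (Or.inr fun j => hs.downward T (fun _ => A j) X (A j) (fun k => (hT' k).nonneg)
      (fun _ => (hA j).nonneg) hX'.nonneg (hA j).nonneg hTX
      ⟨antitone_const, fun _ => tendsto_const_nhds⟩)
  ext v
  refine tendsto_nhds_unique ((hTX.2 v).comp (tendsto_add_atTop_nat 1)) ((hlim v).congr fun k => ?_)
  exact congrArg (fun S : H →L[ℂ] H => S v) (hTs k).symm

variable {ω : Fin n → ℝ}

theorem BetweenHarmArith.fixedPoint_le_arithMean (h : BetweenHarmArith ω 𝔐)
    (hs : IsOperatorMean s) (hω : ∀ j, 0 ≤ ω j) (hω1 : ∑ j, ω j = 1) {A : Fin n → H →L[ℂ] H}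
    (hA : ∀ j, IsStrictlyPositive (A j)) {α : ℝ} (hα : 0 < α) {X : H →L[ℂ] H}
    (hX : IsStrictlyPositive X) (hsα : ∀ j, s X (A j) ≤ (1 - α) • X + α • A j)
    (hfix : X = 𝔐 (fun j => s X (A j))) : X ≤ arithMean ω A := by
  have h1 := (h (fun j => s X (A j)) fun j => hs.isStrictlyPositive hX (hA j)).2
  rw [← hfix] at h1
  have h2 : arithMean ω (fun j => s X (A j)) ≤ ∑ j, ω j • ((1 - α) • X + α • A j) :=
    Finset.sum_le_sum fun j _ => smul_le_smul_of_nonneg_left (hsα j) (hω j)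
  have h3 : ∑ j, ω j • ((1 - α) • X + α • A j) = (1 - α) • X + α • arithMean ω A := by
    simp only [smul_add, Finset.sum_add_distrib, ← Finset.sum_smul, hω1, one_smul, arithMean,
      Finset.smul_sum, smul_comm α]
  have h4 := h1.trans (h2.trans_eq h3)
  -- Subtracting `(1 - α) X` leaves `α X ≤ α arithMean ω A`; the sign of `1 - α` plays no role.
  refine le_of_smul_le_smul_left (a := α) ?_ hα
  rw [← sub_nonneg] at h4 ⊢
  convert h4 using 1
  module

theorem BetweenHarmArith.harmMean_le_fixedPoint (h : BetweenHarmArith ω 𝔐)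
    (hs : IsOperatorMean s) (hω : ∀ j, 0 ≤ ω j) (hω1 : ∑ j, ω j = 1) {A : Fin n → H →L[ℂ] H}
    (hA : ∀ j, IsStrictlyPositive (A j)) {β : ℝ} (hβ : 0 < β) {X : H →L[ℂ] H}
    (hX : IsStrictlyPositive X)
    (hsβ : ∀ j, Ring.inverse (s X (A j)) ≤ (1 - β) • Ring.inverse X + β • Ring.inverse (A j))
    (hfix : X = 𝔐 (fun j => s X (A j))) : harmMean ω A ≤ X := by
  have hsX := fun j => hs.isStrictlyPositive hX (hA j)
  have h1 := (h (fun j => s X (A j)) hsX).1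
  rw [← hfix] at h1
  have h1' := CStarAlgebra.ringInverse_le_ringInverse h1 (isStrictlyPositive_harmMean hω hω1 hsX)
  rw [ringInverse_harmMean hω hω1 hsX] at h1'
  have h2 : ∑ j, ω j • Ring.inverse (s X (A j)) ≤
      ∑ j, ω j • ((1 - β) • Ring.inverse X + β • Ring.inverse (A j)) :=
    Finset.sum_le_sum fun j _ => smul_le_smul_of_nonneg_left (hsβ j) (hω j)
  have h3 : ∑ j, ω j • ((1 - β) • Ring.inverse X + β • Ring.inverse (A j)) =
      (1 - β) • Ring.inverse X + β • Ring.inverse (harmMean ω A) := by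
    rw [ringInverse_harmMean hω hω1 hA]
    simp only [smul_add, Finset.sum_add_distrib, ← Finset.sum_smul, hω1, one_smul,
      Finset.smul_sum, smul_comm β]
  have h4 := h1'.trans (h2.trans_eq h3)
  have h5 : Ring.inverse X ≤ Ring.inverse (harmMean ω A) := by
    refine le_of_smul_le_smul_left (a := β) ?_ hβ
    rw [← sub_nonneg] at h4 ⊢
    convert h4 using 1
    module
  have h6 := CStarAlgebra.ringInverse_le_ringInverse h5 hX.ringInverse
  rwa [Ring.inverse_inverse hX.isUnit,
    Ring.inverse_inverse (isStrictlyPositive_harmMean hω hω1 hA).isUnit] at h6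

end FixedPoint

/-- The deformed mean exists and lies between the weighted harmonic and arithmetic means. -/
theorem deformedMean_bounds {H : Type u} [NormedAddCommGroup H] [InnerProductSpace ℂ H]
    [CompleteSpace H] {n : ℕ} {ω : Fin n → ℝ} (hω : ∀ j, 0 ≤ ω j) (hω1 : ∑ j, ω j = 1)
    {𝔐 : (Fin n → H →L[ℂ] H) → (H →L[ℂ] H)} (h𝔐 : IsMultivariateMean 𝔐)
    (h : BetweenHarmArith ω 𝔐) (σ : OperatorMean.{u}) (hσ : ¬ σ.IsLeftTrivial)
    {m M : ℝ} (hm : 0 < m) (hmM : m ≤ M) {A : Fin n → H →L[ℂ] H}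
    (hmA : ∀ j, m • (1 : H →L[ℂ] H) ≤ A j) (hAM : ∀ j, A j ≤ M • (1 : H →L[ℂ] H)) :
    harmMean ω A ≤ deformedMean 𝔐 σ A ∧ deformedMean 𝔐 σ A ≤ arithMean ω A := by
  have hA := fun j => IsStrictlyPositive.of_smul_one_le hm (hmA j)
  have hs := σ.isOperatorMean H
  obtain ⟨hX, hfix⟩ : IsStrictlyPositive (deformedMean 𝔐 σ A) ∧
      deformedMean 𝔐 σ A = 𝔐 (fun j => σ.op H (deformedMean 𝔐 σ A) (A j)) :=
    -- Existence suffices here: the bounds hold for every positive invertible solution, whichever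
    -- one is chosen.
    Classical.epsilon_spec (p := fun X : H →L[ℂ] H =>
      IsStrictlyPositive X ∧ X = 𝔐 (fun j => σ.op H X (A j)))
      (h𝔐.exists_fixedPoint hs hm hmM hmA hAM)
  obtain ⟨α, β, hα, hβ, hαβ⟩ := σ.exists_affine_bounds hσ
  exact ⟨h.harmMean_le_fixedPoint hs hω hω1 hA hβ hX (fun j => (hαβ H _ _ hX (hA j)).2) hfix,
    h.fixedPoint_le_arithMean hs hω hω1 hA hα hX (fun j => (hαβ H _ _ hX (hA j)).1) hfix⟩

theorem corollary2p3 {H K : Type u}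
    [NormedAddCommGroup H] [InnerProductSpace ℂ H] [CompleteSpace H]
    [NormedAddCommGroup K] [InnerProductSpace ℂ K] [CompleteSpace K]
    {n : ℕ} (m M : ℝ) (hm : 0 < m) (hmM : m < M)
    (A : Fin n → H →L[ℂ] H) (hA : ∀ j, IsStrictlyPositive (A j))
    (hmA : ∀ j, m • (1 : H →L[ℂ] H) ≤ A j) (hAM : ∀ j, A j ≤ M • (1 : H →L[ℂ] H))
    (Φ : (H →L[ℂ] H) →ₚ[ℂ] (K →L[ℂ] K)) (hΦ : Φ 1 = 1)
    (ω : Fin n → ℝ) (hω : ∀ j, 0 ≤ ω j) (hω1 : ∑ j, ω j = 1)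
    (𝔐H : (Fin n → H →L[ℂ] H) → (H →L[ℂ] H)) (h𝔐H : IsMultivariateMean 𝔐H)
    (hωH : BetweenHarmArith ω 𝔐H)
    (𝔐K : (Fin n → K →L[ℂ] K) → (K →L[ℂ] K)) (h𝔐K : IsMultivariateMean 𝔐K)
    (hωK : BetweenHarmArith ω 𝔐K)
    (σ : OperatorMean.{u}) (hσ : ¬ σ.IsLeftTrivial) :
    deformedMean 𝔐K σ (fun j => Φ (A j)) ≤
        ((M + m) ^ 2 / (4 * M * m)) • Φ (deformedMean 𝔐H σ A) ∧
      deformedMean 𝔐K σ (fun j => Φ (A j)) ≤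
        Φ (deformedMean 𝔐H σ A) + (√M - √m) ^ 2 • (1 : K →L[ℂ] K) := by

  have hM : 0 < M := hm.trans hmM
  have hmono : Monotone Φ := OrderHomClass.mono Φ
  have hsmul : ∀ (c : ℝ) (X : H →L[ℂ] H), Φ (c • X) = c • Φ X := fun c X => by
    rw [← Complex.coe_smul, map_smul, Complex.coe_smul]
  have hmΦ : ∀ j, m • (1 : K →L[ℂ] K) ≤ Φ (A j) := fun j => by
    rw [← hΦ, ← hsmul]; exact hmono (hmA j)
  have hΦM : ∀ j, Φ (A j) ≤ M • (1 : K →L[ℂ] K) := fun j => by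
    rw [← hΦ, ← hsmul]; exact hmono (hAM j)
  have hK := (deformedMean_bounds hω hω1 h𝔐K hωK σ hσ hm hmM.le hmΦ hΦM).2
  have hH := hmono (deformedMean_bounds hω hω1 h𝔐H hωH σ hσ hm hmM.le hmA hAM).1
  have harith : arithMean ω (fun j => Φ (A j)) = Φ (arithMean ω A) := by
    simp only [arithMean, map_sum, hsmul]
  rw [harith] at hK
  constructor
  · refine (hK.trans (hmono (arithMean_le_smul_harmMean hω hω1 hm hM hA hmA hAM))).trans ?_
    rw [hsmul]
    exact smul_le_smul_of_nonneg_left hH (by positivity)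
  · refine (hK.trans (hmono (arithMean_le_harmMean_add hω hω1 hm hM hA hmA hAM))).trans ?_
    rw [map_add, hsmul, hΦ]
    exact add_le_add hH le_rfl
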